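/- Let $\varphi:\mathbb R\to\mathbb R$ be an Orlicz N-function, i.e. a continuous, even, convex function, strictly increasing on $(0,\infty)$, with $\varphi(0)=0$, $\varphi(x)/x\to0$ as $x\to0$ and $\varphi(x)/x\to\infty$ as $x\to\infty$. Let $\varphi^{(-1)}:[0,\infty)\to[0,\infty)$ be the inverse of $\varphi|_{[0,\infty)}$, and assume $\varphi^{(-1)}(1)=1$. For a real random variable $Y$ put $$\|Y\|_{\tau_{\tilde\varphi}}:=\sup_{p\ge1}\frac{\|Y\|_p}{\varphi^{(-1)}(p)}\in[0,\infty],\qquad \|Y\|_p=(E|Y|^p)^{1/p}.$$ Let $\mathcal H$ be a Hilbert space with norm $\|\cdot\|$, let $X_1,\dots,X_n$ be independent, identically distributed (strongly measurable) random vectors in $\mathcal H$, and let $\delta>0$ satisfy $n\ge\ln(1/\delta)\ge1$. Then, with probability at least $1-\delta$, $$\Big\|\frac1n\sum_{i=1}^nX_i-E[X_1]\Big\|\le 6e\,\big\|\,\|X_1\|\,\big\|_{\tau_{\tilde\varphi}}\sqrt{\frac{\ln(1/\delta)}{n}}.$$ (If $\|\,\|X_1\|\,\|_{\tau_{\tilde\varphi}}=\infty$,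 in particular if $E[X_1]$ does not exist, the right-hand side is $\infty$ and there is nothing to prove.) -/

import Mathlib

open MeasureTheory ProbabilityTheory Filter Topology
open scoped ENNReal

/-- An Orlicz N-function: a continuous, even, convex function `φ : ℝ → ℝ`, (strictly) increasing
on the positive half-line, with `φ 0 = 0`, `φ x / x → 0` as `x → 0` and `φ x / x → ∞` as
`x → ∞`. -/
structure IsOrliczNFunction (φ : ℝ → ℝ) : Prop where
  continuous : Continuous φ
  even : ∀ x, φ (-x) = φ x
  convexOn : ConvexOn ℝ Set.univ φ
  strictMonoOn : StrictMonoOn φ (Set.Ioi 0)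
  map_zero : φ 0 = 0
  tendsto_div_zero : Tendsto (fun x => φ x / x) (𝓝[≠] 0) (𝓝 0)
  tendsto_div_atTop : Tendsto (fun x => φ x / x) atTop atTop

/-- The inverse function `φ⁽⁻¹⁾` of an N-function `φ`, i.e. the inverse of the bijection
`φ : [0, ∞) → [0, ∞)`. -/
noncomputable def orliczInv (φ : ℝ → ℝ) : ℝ → ℝ :=
  Function.invFunOn φ (Set.Ici 0)

/-- The norm `‖Y‖_{τ_φ̃} = sup_{p ≥ 1} ‖Y‖_p / φ⁽⁻¹⁾(p)` of a real random variable, with value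
`∞` allowed; `p` runs over the real numbers `p ≥ 1`. -/
noncomputable def tauTildeNorm {Ω : Type*} [MeasurableSpace Ω] (φ : ℝ → ℝ) (Y : Ω → ℝ)
    (μ : Measure Ω) : ℝ≥0∞ :=
  ⨆ (p : ℝ) (_ : 1 ≤ p), eLpNorm Y (ENNReal.ofReal p) μ / ENNReal.ofReal (orliczInv φ p)

/-! Convexity with `φ 0 = 0` and `φ 1 = 1` gives `φ⁽⁻¹⁾(p) ≤ p` for `p ≥ 1`, so the `L^m` norms of
`‖X₁‖` are at most `τ m`: the vectors are sub-exponential, and a Bernstein bound suffices. In a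
Hilbert space `cosh ‖·‖` replaces the exponential of a scalar sum. By `cosh_norm_add_le`, adding `y`
to `s` changes it by a term linear in `y`, which a centred vector integrates to zero, plus `cosh
‖s‖` times an exponential remainder of `‖y‖`. Independence then gives `E cosh ‖∑ Yᵢ‖ ≤ (1 + ρ)^n`
(`lintegral_cosh_norm_sum_le`), with no dependence on dimension. The moment growth bounds `ρ`
through `m^m / m! ≤ e^m`, and Markov's inequality with `exp ≤ 2 cosh` yields the tail. -/

/-! ### Hyperbolic cosine of a norm. -/

/-- `cosh` is a power series in the square of its argument with nonnegative coefficients, hence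
convex in that square. -/
lemma cosh_le_of_sq_eq {x a b θ : ℝ} (h0 : 0 ≤ θ) (h1 : θ ≤ 1)
    (h : x ^ 2 = θ * a ^ 2 + (1 - θ) * b ^ 2) :
    Real.cosh x ≤ θ * Real.cosh a + (1 - θ) * Real.cosh b := by
  refine hasSum_le (fun k => ?_) (Real.hasSum_cosh x)
    (((Real.hasSum_cosh a).mul_left θ).add ((Real.hasSum_cosh b).mul_left (1 - θ)))
  have hc := (convexOn_pow (𝕜 := ℝ) k).2 (Set.mem_Ici.2 (sq_nonneg a)) (Set.mem_Ici.2 (sq_nonneg b))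
    h0 (sub_nonneg.2 h1) (by ring)
  simp only [smul_eq_mul] at hc
  rw [← h] at hc
  rw [pow_mul, pow_mul, pow_mul, mul_div_assoc', mul_div_assoc', ← add_div]
  gcongr

lemma cosh_add_le_cosh_add {a r : ℝ} (hr : 0 ≤ r) :
    Real.cosh (a + r) ≤ Real.cosh a + r * Real.sinh a
      + Real.cosh a * (Real.exp r - 1 - r) := by
  have h1 : Real.sinh a ≤ Real.cosh a := (Real.sinh_lt_cosh a).le
  have h2 : r ≤ Real.sinh r := Real.self_le_sinh_iff.2 hr
  rw [Real.cosh_add, ← Real.cosh_add_sinh r]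
  nlinarith [mul_nonneg (sub_nonneg.2 h1) (sub_nonneg.2 h2)]

lemma cosh_sub_le_cosh_sub {a r : ℝ} (ha : 0 ≤ a) (hr : 0 ≤ r) :
    Real.cosh (a - r) ≤ Real.cosh a - r * Real.sinh a
      + Real.cosh a * (Real.exp r - 1 - r) := by
  have h1 : 0 ≤ Real.sinh a := Real.sinh_nonneg_iff.2 ha
  have h2 : r ≤ Real.sinh r := Real.self_le_sinh_iff.2 hr
  rw [Real.cosh_sub, ← Real.cosh_add_sinh r]
  nlinarith [mul_nonneg h1 (sub_nonneg.2 h2),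
    mul_nonneg (Real.cosh_pos a).le (sub_nonneg.2 h2)]

/-- With `c` the cosine of the angle between `s` and `y`, `‖s + y‖²` is the average of `(‖s‖ +
‖y‖)²` and `(‖s‖ - ‖y‖)²` with weights `(1 ± c) / 2`. This reduces the claim to two scalar bounds,
whose linear terms recombine to `c ‖y‖ sinh ‖s‖`. -/
lemma cosh_norm_add_le {H : Type*} [NormedAddCommGroup H] [InnerProductSpace ℝ H] (s y : H) :
    Real.cosh ‖s + y‖ ≤ Real.cosh ‖s‖ + Real.sinh ‖s‖ / ‖s‖ * inner ℝ s y
      + Real.cosh ‖s‖ * (Real.exp ‖y‖ - 1 - ‖y‖) := by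
  obtain ⟨c, hc1, hc2, hc⟩ : ∃ c : ℝ, -1 ≤ c ∧ c ≤ 1 ∧ inner ℝ s y = c * (‖s‖ * ‖y‖) := by
    have h := abs_le.1 (abs_real_inner_div_norm_mul_norm_le_one s y)
    refine ⟨_, h.1, h.2, ?_⟩
    by_cases h0 : ‖s‖ * ‖y‖ = 0
    · rw [h0, mul_zero]
      rcases mul_eq_zero.1 h0 with h | h <;> rw [norm_eq_zero] at h <;> simp [h]
    · rw [div_mul_cancel₀ _ h0]
  have hd : Real.sinh ‖s‖ / ‖s‖ * inner ℝ s y = c * (‖y‖ * Real.sinh ‖s‖) := by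
    by_cases h0 : ‖s‖ = 0
    · simp [h0]
    · rw [hc]; field_simp
  have key := cosh_le_of_sq_eq (x := ‖s + y‖) (a := ‖s‖ + ‖y‖) (b := ‖s‖ - ‖y‖)
    (θ := (1 + c) / 2) (by linarith) (by linarith)
    (by rw [norm_add_sq_real, hc]; ring)
  have h1 := mul_le_mul_of_nonneg_left
    (cosh_add_le_cosh_add (a := ‖s‖) (norm_nonneg y)) (by linarith : 0 ≤ (1 + c) / 2)
  have h2 := mul_le_mul_of_nonneg_left
    (cosh_sub_le_cosh_sub (norm_nonneg s) (norm_nonneg y)) (by linarith : 0 ≤ 1 - (1 + c) / 2)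
  rw [hd]
  linarith

/-! ### From moment growth to the exponential remainder. -/

lemma hasSum_exp_sub_one_sub (x : ℝ) :
    HasSum (fun k : ℕ => x ^ (k + 2) / (k + 2).factorial) (Real.exp x - 1 - x) := by
  have h := (hasSum_nat_add_iff' 2).2 (NormedSpace.expSeries_div_hasSum_exp x)
  rw [← Real.exp_eq_exp_ℝ] at h
  have h2 : ∑ i ∈ Finset.range 2, x ^ i / (i.factorial : ℝ) = 1 + x := by
    simp [Finset.sum_range_succ]
  rwa [h2, ← sub_sub] at h

/-- If the `L^m` norm of `W` is at most `K (m + 1)` for all natural `m ≥ 2`, then the exponential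
remainder of `v / (e K) * W` has expectation at most `e v² / (1 - v)`. -/
lemma lintegral_exp_sub_one_sub_le {Ω : Type*} [MeasurableSpace Ω] {μ : Measure Ω}
    {W : Ω → ℝ} (hW : AEMeasurable W μ) (hW0 : ∀ ω, 0 ≤ W ω) {K : ℝ} (hK : 0 < K)
    (hm : ∀ m : ℕ, 2 ≤ m → eLpNorm W m μ ≤ ENNReal.ofReal (K * (m + 1)))
    {v : ℝ} (hv0 : 0 < v) (hv1 : v < 1) :
    ∫⁻ ω, ENNReal.ofReal (Real.exp (v / (Real.exp 1 * K) * W ω) - 1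
        - v / (Real.exp 1 * K) * W ω) ∂μ
      ≤ ENNReal.ofReal (Real.exp 1 * v ^ 2 / (1 - v)) := by
  set t := v / (Real.exp 1 * K) with ht
  have ht0 : 0 < t := by positivity
  have hpt : ∀ ω, ENNReal.ofReal (Real.exp (t * W ω) - 1 - t * W ω)
      = ∑' k : ℕ, ENNReal.ofReal (t ^ (k + 2) / (k + 2).factorial) * ‖W ω‖ₑ ^ (k + 2) := by
    intro ω
    have h := hasSum_exp_sub_one_sub (t * W ω)
    rw [← h.tsum_eq, ENNReal.ofReal_tsum_of_nonneg
      (fun k => by have := hW0 ω; positivity) h.summable]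
    refine tsum_congr fun k => ?_
    rw [Real.enorm_eq_ofReal (hW0 ω), ← ENNReal.ofReal_pow (hW0 ω),
      ← ENNReal.ofReal_mul (by positivity)]
    congr 1; ring
  simp_rw [hpt]
  rw [lintegral_tsum (fun k => by fun_prop)]
  have hg : HasSum (fun k : ℕ => Real.exp 1 * v ^ 2 * v ^ k) (Real.exp 1 * v ^ 2 / (1 - v)) := by
    simpa [div_eq_mul_inv] using
      (hasSum_geometric_of_lt_one hv0.le hv1).mul_left (Real.exp 1 * v ^ 2)
  rw [← hg.tsum_eq, ENNReal.ofReal_tsum_of_nonneg (fun k => by positivity) hg.summable]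
  refine ENNReal.tsum_le_tsum fun k => ?_
  rw [lintegral_const_mul'' _ (by fun_prop)]
  have hmom : ∫⁻ ω, ‖W ω‖ₑ ^ (k + 2) ∂μ
      ≤ ENNReal.ofReal ((K * (((k + 2 : ℕ) : ℝ) + 1)) ^ (k + 2)) := by
    have h := hm (k + 2) (by omega)
    have h2 := eLpNorm_nnreal_pow_eq_lintegral (f := W) (μ := μ) (p := ((k + 2 : ℕ) : NNReal))
      (by positivity)
    simp only [NNReal.coe_natCast, ENNReal.rpow_natCast, ENNReal.coe_natCast] at h2
    rw [← h2, ENNReal.ofReal_pow (by positivity)]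
    gcongr
  refine (mul_le_mul_right hmom _).trans ?_
  rw [← ENNReal.ofReal_mul (by positivity)]
  apply ENNReal.ofReal_le_ofReal
  -- With `m = k + 2`, the exponent `m + 1` makes one factor `m + 1` cancel, leaving `(m + 1)^m / m!
  -- ≤ e^(m + 1)`. The extra `e` is the factor in the final bound.
  have hf := Real.pow_div_factorial_le_exp (((k + 2 : ℕ) : ℝ) + 1) (by positivity) (k + 3)
  have hf' : (((k + 2 : ℕ) : ℝ) + 1) ^ (k + 2) / (k + 2).factorial
      ≤ Real.exp 1 ^ (k + 3) := by
    rw [← Real.exp_nat_mul, mul_one]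
    convert hf using 1
    · rw [Nat.factorial_succ (k + 2)]; push_cast
      field_simp
      ring
    · push_cast; ring_nf
  calc t ^ (k + 2) / (k + 2).factorial * (K * (((k + 2 : ℕ) : ℝ) + 1)) ^ (k + 2)
      = (t * K) ^ (k + 2) * ((((k + 2 : ℕ) : ℝ) + 1) ^ (k + 2) / (k + 2).factorial) := by
        rw [mul_pow, mul_pow]; ring
    _ ≤ (t * K) ^ (k + 2) * Real.exp 1 ^ (k + 3) := by gcongr
    _ = Real.exp 1 * v ^ 2 * v ^ k := by
        rw [pow_succ (Real.exp 1), ← mul_assoc, ← mul_pow,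
          show t * K * Real.exp 1 = v by rw [ht]; field_simp]
        ring

/-! ### Sums of independent centred vectors. -/

section cosh_norm_sum

variable {Ω H : Type*} [MeasurableSpace Ω] {μ : Measure Ω} [IsProbabilityMeasure μ]
  [NormedAddCommGroup H] [InnerProductSpace ℝ H] [CompleteSpace H]
  [SecondCountableTopology H] [MeasurableSpace H] [BorelSpace H]

lemma lintegral_cosh_norm_add_le (s : H) {Y : Ω → H} (hY : Integrable Y μ)
    (hY0 : ∫ ω, Y ω ∂μ = 0) {ρ : ℝ≥0∞} (hρt : ρ ≠ ∞)
    (hρ : ∫⁻ ω, ENNReal.ofReal (Real.exp ‖Y ω‖ - 1 - ‖Y ω‖) ∂μ ≤ ρ) :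
    ∫⁻ ω, ENNReal.ofReal (Real.cosh ‖s + Y ω‖) ∂μ
      ≤ ENNReal.ofReal (Real.cosh ‖s‖) * (1 + ρ) := by
  have hr0 : ∀ ω, 0 ≤ Real.exp ‖Y ω‖ - 1 - ‖Y ω‖ := fun ω => by
    linarith [Real.add_one_le_exp ‖Y ω‖]
  have hYm : AEMeasurable Y μ := hY.aemeasurable
  have hrint : Integrable (fun ω => Real.exp ‖Y ω‖ - 1 - ‖Y ω‖) μ := by
    refine ⟨by have := hYm.norm; fun_prop, ?_⟩
    rw [hasFiniteIntegral_iff_ofReal (ae_of_all _ hr0)]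
    exact hρ.trans_lt hρt.lt_top
  have hinn : Integrable (fun ω => inner ℝ s (Y ω)) μ := hY.const_inner s
  have hint := ((integrable_const (μ := μ) (Real.cosh ‖s‖)).add
    (hinn.const_mul (Real.sinh ‖s‖ / ‖s‖))).add (hrint.const_mul (Real.cosh ‖s‖))
  refine (lintegral_mono fun ω => ENNReal.ofReal_le_ofReal (cosh_norm_add_le s (Y ω))).trans ?_
  have heq := ofReal_integral_eq_lintegral_ofReal hint
    (ae_of_all _ fun ω => (Real.cosh_pos _).le.trans (cosh_norm_add_le s (Y ω)))
  simp only [Pi.add_apply] at heq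
  rw [← heq]
  erw [integral_add ((integrable_const (Real.cosh ‖s‖)).add (hinn.const_mul _))
    (hrint.const_mul _)]
  erw [integral_add (integrable_const _) (hinn.const_mul _)]
  rw [integral_const_mul, integral_const_mul, integral_inner hY s, hY0]
  simp only [integral_const, probReal_univ, one_smul, inner_zero_right, mul_zero, add_zero]
  rw [← mul_one_add, ENNReal.ofReal_mul (Real.cosh_pos _).le,
    ENNReal.ofReal_add zero_le_one (integral_nonneg hr0), ENNReal.ofReal_one,
    ofReal_integral_eq_lintegral_ofReal hrint (ae_of_all _ hr0)]
  gcongr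

/-- Bound on the hyperbolic cosine of the norm of a sum of independent centred random vectors in a
Hilbert space. -/
lemma lintegral_cosh_norm_sum_le {ι : Type*} {Y : ι → Ω → H} (hind : iIndepFun Y μ)
    (hY : ∀ i, Integrable (Y i) μ) (hY0 : ∀ i, ∫ ω, Y i ω ∂μ = 0) {ρ : ℝ≥0∞} (hρt : ρ ≠ ∞)
    (hρ : ∀ i, ∫⁻ ω, ENNReal.ofReal (Real.exp ‖Y i ω‖ - 1 - ‖Y i ω‖) ∂μ ≤ ρ) (s : Finset ι) :
    ∫⁻ ω, ENNReal.ofReal (Real.cosh ‖∑ i ∈ s, Y i ω‖) ∂μ ≤ (1 + ρ) ^ s.card := by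
  classical
  -- By Fubini the partial sum can be frozen while the new summand is integrated, costing one factor
  -- `1 + ρ`.
  induction s using Finset.induction_on with
  | empty => simp
  | insert i s hi ih =>
    have hm : ∀ i, AEMeasurable (Y i) μ := fun i => (hY i).aemeasurable
    have hmS : AEMeasurable (∑ j ∈ s, Y j) μ := by fun_prop
    have hI : IndepFun (∑ j ∈ s, Y j) (Y i) μ := hind.indepFun_finsetSum_of_notMem₀ hm hi
    have hpair := (indepFun_iff_map_prod_eq_prod_map_map hmS (hm i)).1 hI
    have hF : Measurable fun p : H × H => ENNReal.ofReal (Real.cosh ‖p.1 + p.2‖) := by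
      fun_prop
    have := Measure.isProbabilityMeasure_map hmS (μ := μ)
    have := Measure.isProbabilityMeasure_map (hm i) (μ := μ)
    calc ∫⁻ ω, ENNReal.ofReal (Real.cosh ‖∑ j ∈ insert i s, Y j ω‖) ∂μ
        = ∫⁻ p, ENNReal.ofReal (Real.cosh ‖p.1 + p.2‖)
            ∂(μ.map fun ω => ((∑ j ∈ s, Y j) ω, Y i ω)) := by
          rw [lintegral_map' hF.aemeasurable (hmS.prodMk (hm i))]
          simp [Finset.sum_insert hi, add_comm]
      _ = ∫⁻ x, ∫⁻ y, ENNReal.ofReal (Real.cosh ‖x + y‖) ∂(μ.map (Y i))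
            ∂(μ.map (∑ j ∈ s, Y j)) := by
          rw [hpair, lintegral_prod _ hF.aemeasurable]
      _ ≤ ∫⁻ x, ENNReal.ofReal (Real.cosh ‖x‖) * (1 + ρ) ∂(μ.map (∑ j ∈ s, Y j)) := by
          refine lintegral_mono fun x => ?_
          rw [lintegral_map' (by fun_prop) (hm i)]
          exact lintegral_cosh_norm_add_le x (hY i) (hY0 i) hρt (hρ i)
      _ = (∫⁻ ω, ENNReal.ofReal (Real.cosh ‖∑ j ∈ s, Y j ω‖) ∂μ) * (1 + ρ) := by
          rw [lintegral_mul_const _ (by fun_prop), lintegral_map' (by fun_prop) hmS]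
          simp
      _ ≤ (1 + ρ) ^ (insert i s).card := by
          rw [Finset.card_insert_of_notMem hi, pow_succ]
          gcongr

end cosh_norm_sum

/-! ### Centring and the Bernstein inequality. -/

lemma exp_sub_one_sub_mono {a b : ℝ} (ha : 0 ≤ a) (hab : a ≤ b) :
    Real.exp a - 1 - a ≤ Real.exp b - 1 - b := by
  have h1 : Real.exp b = Real.exp a * Real.exp (b - a) := by rw [← Real.exp_add]; ring_nf
  have h2 := Real.add_one_le_exp (b - a)
  have h3 := Real.one_le_exp ha
  nlinarith [mul_le_mul_of_nonneg_left h2 (Real.exp_pos a).le]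

lemma exp_le_two_mul_cosh (x : ℝ) : Real.exp x ≤ 2 * Real.cosh x := by
  rw [Real.cosh_eq]; linarith [Real.exp_pos (-x)]

/-- The case `m = 1` bounds the mean by `K`, so `‖X - E X‖ ≤ ‖X‖ + K`, and Minkowski turns `K m`
into `K (m + 1)`. -/
lemma lintegral_exp_norm_sub_le {Ω H : Type*} [MeasurableSpace Ω] {μ : Measure Ω}
    [IsProbabilityMeasure μ] [NormedAddCommGroup H] [NormedSpace ℝ H]
    {X : Ω → H} (hX : AEStronglyMeasurable X μ) {K : ℝ} (hK : 0 < K)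
    (hm : ∀ m : ℕ, 1 ≤ m → eLpNorm X m μ ≤ ENNReal.ofReal (K * m))
    {v : ℝ} (hv0 : 0 < v) (hv1 : v < 1) :
    ∫⁻ ω, ENNReal.ofReal (Real.exp ‖(v / (Real.exp 1 * K)) • (X ω - ∫ ω', X ω' ∂μ)‖ - 1
        - ‖(v / (Real.exp 1 * K)) • (X ω - ∫ ω', X ω' ∂μ)‖) ∂μ
      ≤ ENNReal.ofReal (Real.exp 1 * v ^ 2 / (1 - v)) := by
  have ht0 : 0 < v / (Real.exp 1 * K) := by positivity
  have hmean : ‖∫ ω', X ω' ∂μ‖ ≤ K := by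
    have h1 : ‖∫ ω', X ω' ∂μ‖ₑ ≤ ENNReal.ofReal K := by
      refine (enorm_integral_le_lintegral_enorm X).trans ?_
      rw [← eLpNorm_one_eq_lintegral_enorm]
      simpa using hm 1 le_rfl
    rwa [← ofReal_norm, ENNReal.ofReal_le_ofReal_iff hK.le] at h1
  refine (lintegral_mono fun ω => ENNReal.ofReal_le_ofReal ?_).trans
    (lintegral_exp_sub_one_sub_le (W := fun ω => ‖X ω‖ + K) (hX.norm.aemeasurable.add_const K)
      (fun ω => by positivity) hK (fun m h2 => ?_) hv0 hv1)
  · refine exp_sub_one_sub_mono (norm_nonneg _) ?_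
    rw [norm_smul, Real.norm_of_nonneg ht0.le]
    have := norm_sub_le (X ω) (∫ ω', X ω' ∂μ)
    gcongr
    linarith
  · have hm1 : (1 : ℝ≥0∞) ≤ m := by exact_mod_cast (by omega : 1 ≤ m)
    refine (eLpNorm_add_le (f := fun ω => ‖X ω‖) (g := fun _ => K) hX.norm
      aestronglyMeasurable_const hm1).trans ?_
    rw [eLpNorm_norm, eLpNorm_const _ (by positivity) (IsProbabilityMeasure.ne_zero μ), measure_univ,
      ENNReal.one_rpow, mul_one, Real.enorm_eq_ofReal hK.le, mul_add, mul_one,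
      ENNReal.ofReal_add (by positivity) hK.le]
    gcongr
    exact hm m (by omega)

/-- The exponents balance as `0.7 - 2.64 + 0.94 = -1`: `2 ≤ e^(0.7 L)` because `L ≥ 1`, `6 · 0.44 =
2.64`, and `e · 0.44² / (1 - 0.44) < 0.94`. Since `L ≤ N`, `v ≤ 0.44`. -/
lemma two_mul_exp_neg_mul_pow_le_exp_neg {L : ℝ} (hL : 1 ≤ L) {N : ℕ} (hN : L ≤ N) {v : ℝ}
    (hv : v = 0.44 * √(L / N)) :
    2 * Real.exp (-(6 * N * √(L / N) * v)) * (1 + Real.exp 1 * v ^ 2 / (1 - v)) ^ N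
      ≤ Real.exp (-L) := by
  have hN0 : (0 : ℝ) < N := by linarith
  have hs2 : √(L / N) ^ 2 = L / N := Real.sq_sqrt (by positivity)
  have hs1 : √(L / N) ≤ 1 := Real.sqrt_le_one.2 ((div_le_one hN0).2 hN)
  have hv0 : 0 ≤ v := by rw [hv]; positivity
  have hvle : v ≤ 0.44 := by rw [hv]; linarith
  have h1v : (0 : ℝ) < 1 - v := by linarith
  have hNv : N * v ^ 2 = 0.1936 * L := by
    rw [hv, mul_pow, hs2]; field_simp; norm_num
  have hNsv : 6 * N * √(L / N) * v = 2.64 * L := by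
    rw [hv, show 6 * N * √(L / N) * (0.44 * √(L / N)) = 2.64 * N * √(L / N) ^ 2 by ring, hs2]
    field_simp
  have hpow : (1 + Real.exp 1 * v ^ 2 / (1 - v)) ^ N ≤ Real.exp (0.94 * L) := by
    calc (1 + Real.exp 1 * v ^ 2 / (1 - v)) ^ N
        ≤ Real.exp (Real.exp 1 * v ^ 2 / (1 - v)) ^ N := by
          gcongr
          linarith [Real.add_one_le_exp (Real.exp 1 * v ^ 2 / (1 - v))]
      _ = Real.exp (Real.exp 1 * (N * v ^ 2) / (1 - v)) := by
          rw [← Real.exp_nat_mul]; ring_nf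
      _ ≤ Real.exp (0.94 * L) := by
          rw [hNv, Real.exp_le_exp, div_le_iff₀ h1v]
          have := Real.exp_one_lt_d9
          nlinarith
  have h2 : (2 : ℝ) ≤ Real.exp (0.7 * L) := by
    rw [← Real.log_le_iff_le_exp (by norm_num)]
    linarith [Real.log_two_lt_d9]
  rw [hNsv]
  calc 2 * Real.exp (-(2.64 * L)) * (1 + Real.exp 1 * v ^ 2 / (1 - v)) ^ N
      ≤ Real.exp (0.7 * L) * Real.exp (-(2.64 * L)) * Real.exp (0.94 * L) := by gcongr
    _ = Real.exp (-L) := by rw [← Real.exp_add, ← Real.exp_add]; ring_nf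

/-- Bernstein inequality for independent sub-exponential random vectors in a separable Hilbert
space. -/
lemma measure_lt_norm_average_sub_le {Ω H : Type*} [MeasurableSpace Ω] {μ : Measure Ω}
    [IsProbabilityMeasure μ] [NormedAddCommGroup H] [InnerProductSpace ℝ H] [CompleteSpace H]
    [SecondCountableTopology H] [MeasurableSpace H] [BorelSpace H] {n : ℕ} {X : Fin n → Ω → H}
    (hX : ∀ i, AEStronglyMeasurable (X i) μ) (hind : iIndepFun X μ) {M : H}
    (hM : ∀ i, ∫ ω, X i ω ∂μ = M) {K : ℝ} (hK : 0 < K)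
    (hm : ∀ i, ∀ m : ℕ, 1 ≤ m → eLpNorm (X i) m μ ≤ ENNReal.ofReal (K * m))
    {L : ℝ} (hL : 1 ≤ L) (hn : L ≤ n) :
    μ {ω | 6 * Real.exp 1 * K * √(L / n) < ‖(1 / n : ℝ) • ∑ i, X i ω - M‖}
      ≤ ENNReal.ofReal (Real.exp (-L)) := by
  have hn0 : (0 : ℝ) < n := by linarith
  have hs0 : 0 < √(L / n) := Real.sqrt_pos.2 (by positivity)
  have hs1 : √(L / n) ≤ 1 := Real.sqrt_le_one.2 ((div_le_one hn0).2 hn)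
  obtain ⟨v, hv⟩ : ∃ v, v = 0.44 * √(L / n) := ⟨_, rfl⟩
  have hv0 : 0 < v := by rw [hv]; positivity
  have hv1 : v < 1 := by rw [hv]; linarith
  set t := v / (Real.exp 1 * K) with ht
  have ht0 : 0 < t := by positivity
  have hXi : ∀ i, Integrable (X i) μ := fun i => by
    rw [← memLp_one_iff_integrable]
    exact ⟨hX i, ((by simpa using hm i 1 le_rfl : eLpNorm (X i) 1 μ ≤ _)).trans_lt
      ENNReal.ofReal_lt_top⟩
  have hind' : iIndepFun (fun i ω => t • (X i ω - M)) μ :=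
    hind.comp (fun _ x => t • (x - M)) (fun _ => by fun_prop)
  have hmgf := lintegral_cosh_norm_sum_le (μ := μ) (Y := fun i ω => t • (X i ω - M)) hind'
    (fun i => ((hXi i).sub (integrable_const M)).smul t)
    (fun i => by
      rw [integral_smul, integral_sub (hXi i) (integrable_const M), hM]; simp)
    ENNReal.ofReal_ne_top
    (fun i => by
      have := lintegral_exp_norm_sub_le (hX i) hK (hm i) hv0 hv1
      rwa [hM] at this) Finset.univ
  rw [Finset.card_univ, Fintype.card_fin] at hmgf
  have hsum : ∀ ω, ∑ i, t • (X i ω - M) = (t * n) • ((1 / n : ℝ) • ∑ i, X i ω - M) := by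
    intro ω
    rw [← Finset.smul_sum, Finset.sum_sub_distrib, mul_smul, smul_sub (n : ℝ), smul_smul (n : ℝ),
      mul_one_div_cancel hn0.ne', one_smul]
    simp [Nat.cast_smul_eq_nsmul]
  set R := 6 * n * √(L / n) * v with hR
  -- The scale `t = v / (e K)` cancels `e K` in the threshold, so the Markov level depends only on
  -- `L` and `n`.
  have hRt : t * n * (6 * Real.exp 1 * K * √(L / n)) = R := by
    rw [hR, ht]; field_simp
  set S : Ω → ℝ≥0∞ := fun ω => ENNReal.ofReal (Real.cosh ‖∑ i, t • (X i ω - M)‖) with hS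
  have hXm : ∀ i, AEMeasurable (X i) μ := fun i => (hX i).aemeasurable
  have hSm : AEMeasurable S μ := by fun_prop
  have hmark := mul_meas_ge_le_lintegral₀ hSm (ENNReal.ofReal (Real.exp R / 2))
  have hsub : {ω | 6 * Real.exp 1 * K * √(L / n) < ‖(1 / n : ℝ) • ∑ i, X i ω - M‖}
      ⊆ {ω | ENNReal.ofReal (Real.exp R / 2) ≤ S ω} := by
    intro ω hω
    refine ENNReal.ofReal_le_ofReal ?_
    rw [hsum, norm_smul, Real.norm_of_nonneg (by positivity)]
    have h1 : R ≤ t * n * ‖(1 / n : ℝ) • ∑ i, X i ω - M‖ := by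
      rw [← hRt]
      exact mul_le_mul_of_nonneg_left (le_of_lt hω) (by positivity)
    have h2 := exp_le_two_mul_cosh (t * n * ‖(1 / n : ℝ) • ∑ i, X i ω - M‖)
    have h3 := Real.exp_le_exp.2 h1
    linarith
  have h1v : (0 : ℝ) < 1 - v := by linarith
  calc μ {ω | 6 * Real.exp 1 * K * √(L / n) < ‖(1 / n : ℝ) • ∑ i, X i ω - M‖}
      ≤ μ {ω | ENNReal.ofReal (Real.exp R / 2) ≤ S ω} := measure_mono hsub
    _ = ENNReal.ofReal (2 * Real.exp (-R)) *
          (ENNReal.ofReal (Real.exp R / 2) * μ {ω | ENNReal.ofReal (Real.exp R / 2) ≤ S ω}) := by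
        rw [← mul_assoc, ← ENNReal.ofReal_mul (by positivity),
          show 2 * Real.exp (-R) * (Real.exp R / 2) = 1 by rw [Real.exp_neg]; field_simp,
          ENNReal.ofReal_one, one_mul]
    _ ≤ ENNReal.ofReal (2 * Real.exp (-R)) *
          (1 + ENNReal.ofReal (Real.exp 1 * v ^ 2 / (1 - v))) ^ n := by
        gcongr
        exact hmark.trans hmgf
    _ = ENNReal.ofReal (2 * Real.exp (-R) * (1 + Real.exp 1 * v ^ 2 / (1 - v)) ^ n) := by
        rw [ENNReal.ofReal_mul (p := 2 * Real.exp (-R)) (by positivity),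
          ENNReal.ofReal_pow (by positivity), ENNReal.ofReal_add zero_le_one (by positivity), ENNReal.ofReal_one]
    _ ≤ ENNReal.ofReal (Real.exp (-L)) :=
        ENNReal.ofReal_le_ofReal (two_mul_exp_neg_mul_pow_le_exp_neg hL hn hv)

/-- Bernstein inequality for independent sub-exponential strongly measurable random vectors in a
Hilbert space. -/
lemma measure_lt_norm_average_sub_le_of_aestronglyMeasurable
    {Ω H : Type*} [MeasurableSpace Ω] {μ : Measure Ω}
    [IsProbabilityMeasure μ] [NormedAddCommGroup H] [InnerProductSpace ℝ H] [CompleteSpace H]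
    [MeasurableSpace H] [BorelSpace H] {n : ℕ} {X : Fin n → Ω → H}
    (hX : ∀ i, AEStronglyMeasurable (X i) μ) (hind : iIndepFun X μ) {M : H}
    (hM : ∀ i, ∫ ω, X i ω ∂μ = M) {K : ℝ} (hK : 0 < K)
    (hm : ∀ i, ∀ m : ℕ, 1 ≤ m → eLpNorm (X i) m μ ≤ ENNReal.ofReal (K * m))
    {L : ℝ} (hL : 1 ≤ L) (hn : L ≤ n) :
    μ {ω | 6 * Real.exp 1 * K * √(L / n) < ‖(1 / n : ℝ) • ∑ i, X i ω - M‖}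
      ≤ ENNReal.ofReal (Real.exp (-L)) := by
  -- Almost surely every `X i` lies in the closed span `V` of the ranges of strongly measurable
  -- versions. `V` is separable, and projecting onto it changes neither the norms nor the average,
  -- almost surely.
  set T : Set H := ⋃ i, Set.range ((hX i).mk (X i)) with hT
  have hTs : TopologicalSpace.IsSeparable T :=
    TopologicalSpace.IsSeparable.iUnion fun i => (hX i).stronglyMeasurable_mk.isSeparable_range
  set V : Submodule ℝ H := (Submodule.span ℝ T).topologicalClosure with hV
  have hVs : TopologicalSpace.IsSeparable (V : Set H) := by
    rw [hV, Submodule.topologicalClosure_coe]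
    exact hTs.span.closure
  have : SecondCountableTopology V := hVs.secondCountableTopology
  have : CompleteSpace V := (Submodule.isClosed_topologicalClosure _).completeSpace_coe
  have hmem : ∀ i, ∀ᵐ ω ∂μ, X i ω ∈ V := fun i => by
    filter_upwards [(hX i).ae_eq_mk] with ω hω
    rw [hω]
    exact Submodule.le_topologicalClosure _
      (Submodule.subset_span (Set.mem_iUnion.2 ⟨i, ω, rfl⟩))
  set P := V.orthogonalProjectionOnto with hP
  have hPX : ∀ i, ∀ᵐ ω ∂μ, ((P (X i ω) : V) : H) = X i ω := fun i => by
    filter_upwards [hmem i] with ω hω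
    exact V.starProjection_eq_self_iff.2 hω
  have hXi : ∀ i, Integrable (X i) μ := fun i => by
    rw [← memLp_one_iff_integrable]
    exact ⟨hX i, ((by simpa using hm i 1 le_rfl : eLpNorm (X i) 1 μ ≤ _)).trans_lt
      ENNReal.ofReal_lt_top⟩
  have key := measure_lt_norm_average_sub_le (μ := μ) (X := fun i ω => P (X i ω)) (M := P M)
    (fun i => P.continuous.comp_aestronglyMeasurable (hX i))
    (hind.comp (fun _ x => P x) (fun _ => P.continuous.measurable))
    (fun i => by rw [P.integral_comp_comm (hXi i), hM]) hK
    (fun i m h => by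
      rw [eLpNorm_congr_norm_ae (g := X i)]
      · exact hm i m h
      · filter_upwards [hPX i] with ω hω
        rw [Submodule.coe_norm, hω]) hL hn
  refine (measure_mono_ae ?_).trans key
  have hall : ∀ᵐ ω ∂μ, ∀ i, ((P (X i ω) : V) : H) = X i ω := ae_all_iff.2 hPX
  have hPM : 0 < n → ((P M : V) : H) = M := fun h0 => by
    have i : Fin n := ⟨0, h0⟩
    rw [← hM i, ← P.integral_comp_comm (hXi i)]
    exact (V.subtypeL.integral_comp_comm (P.integrable_comp (hXi i))).symm.trans
      (integral_congr_ae (hPX i))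
  have hn0 : 0 < n := by
    have : (0 : ℝ) < n := by linarith
    exact_mod_cast this
  filter_upwards [hall] with ω hω h
  have heq : (((1 / n : ℝ) • ∑ i, P (X i ω) - P M : V) : H)
      = (1 / n : ℝ) • ∑ i, X i ω - M := by
    push_cast
    rw [hPM hn0]
    simp [hω]
  change _ < ‖(1 / n : ℝ) • ∑ i, P (X i ω) - P M‖
  rw [Submodule.coe_norm, heq]
  exact h

/-! ### The inverse N-function and the moment bound. -/

lemma orliczInv_spec {φ : ℝ → ℝ} (hφ : IsOrliczNFunction φ) {y : ℝ} (hy : 0 ≤ y) :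
    0 ≤ orliczInv φ y ∧ φ (orliczInv φ y) = y := by
  have hex : ∃ a ∈ Set.Ici (0 : ℝ), φ a = y := by
    obtain ⟨x, hx1, hx2⟩ := ((hφ.tendsto_div_atTop.eventually_ge_atTop y).and
      (eventually_ge_atTop 1)).exists
    have hφx : y ≤ φ x := by
      rw [le_div_iff₀ (by linarith)] at hx1
      nlinarith
    obtain ⟨a, ha, h⟩ := intermediate_value_Icc (by linarith : (0 : ℝ) ≤ x)
      hφ.continuous.continuousOn (⟨by rwa [hφ.map_zero], hφx⟩ : y ∈ Set.Icc (φ 0) (φ x))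
    exact ⟨a, ha.1, h⟩
  exact ⟨Function.invFunOn_mem hex, Function.invFunOn_eq hex⟩

lemma orliczInv_le_self {φ : ℝ → ℝ} (hφ : IsOrliczNFunction φ) (hφ1 : orliczInv φ 1 = 1)
    {p : ℝ} (hp : 1 ≤ p) : orliczInv φ p ≤ p := by
  have h1 : φ 1 = 1 := by simpa [hφ1] using (orliczInv_spec hφ zero_le_one).2
  obtain ⟨-, h⟩ := orliczInv_spec hφ (zero_le_one.trans hp)
  set x := orliczInv φ p
  by_contra! hx
  have hx0 : 0 < x := by linarith
  -- Since `1 = x⁻¹ x + (1 - x⁻¹) 0`, convexity gives `1 = φ 1 ≤ φ x / x = p / x`, against `p < x`.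
  have hc := hφ.convexOn.2 (Set.mem_univ x) (Set.mem_univ 0) (inv_nonneg.2 hx0.le)
    (sub_nonneg.2 (inv_le_one_of_one_le₀ (hp.trans hx.le))) (by ring)
  simp only [smul_eq_mul, mul_zero, add_zero, inv_mul_cancel₀ hx0.ne', h1, h, hφ.map_zero] at hc
  rw [← div_eq_inv_mul, one_le_div hx0] at hc
  linarith

lemma eLpNorm_le_tauTildeNorm_mul {Ω : Type*} [MeasurableSpace Ω] {μ : Measure Ω} {φ : ℝ → ℝ}
    (hφ : IsOrliczNFunction φ) (hφ1 : orliczInv φ 1 = 1) (Y : Ω → ℝ) {m : ℕ} (hm : 1 ≤ m) :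
    eLpNorm Y m μ ≤ tauTildeNorm φ Y μ * m := by
  have hm' : (1 : ℝ) ≤ m := by exact_mod_cast hm
  obtain ⟨h0, h⟩ := orliczInv_spec hφ (zero_le_one.trans hm')
  have hpos : 0 < orliczInv φ m := h0.lt_of_ne fun h' => by
    rw [← h', hφ.map_zero] at h; linarith
  have hle : eLpNorm Y m μ / ENNReal.ofReal (orliczInv φ m) ≤ tauTildeNorm φ Y μ := by
    have := le_iSup₂ (f := fun (p : ℝ) (_ : 1 ≤ p) =>
      eLpNorm Y (ENNReal.ofReal p) μ / ENNReal.ofReal (orliczInv φ p)) (m : ℝ) hm'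
    rwa [ENNReal.ofReal_natCast] at this
  rw [ENNReal.div_le_iff (by simpa using hpos) ENNReal.ofReal_ne_top] at hle
  refine hle.trans ?_
  gcongr
  simpa using ENNReal.ofReal_le_ofReal (orliczInv_le_self hφ hφ1 hm')

/-- The real inner product `re ⟪x, y⟫` on a `𝕜`-inner product space, compatible with a prescribed
real normed space structure. -/
@[reducible] noncomputable def innerProductSpaceReal (𝕜 H : Type*) [RCLike 𝕜]
    [NormedAddCommGroup H] [InnerProductSpace 𝕜 H] [NormedSpace ℝ H] : InnerProductSpace ℝ H where
  inner x y := RCLike.re (inner 𝕜 x y)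
  norm_sq_eq_re_inner x := norm_sq_eq_re_inner (𝕜 := 𝕜) x
  conj_inner_symm x y := inner_re_symm (𝕜 := 𝕜) y x
  add_left x y z := by simp [inner_add_left]
  smul_left x y r :=
    -- The prescribed real scalar action is not assumed to come from `𝕜`; a continuous additive map
    -- between real normed spaces is automatically `ℝ`-linear.
    map_real_smul ({ toFun := fun x => RCLike.re (inner 𝕜 x y)
                     map_zero' := by simp
                     map_add' := fun a b => by simp [inner_add_left] } : H →+ ℝ)
      (by
        change Continuous fun x => RCLike.re (inner 𝕜 x y)
        fun_prop) r x

theorem mainTheorem5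
    {Ω : Type*} [MeasurableSpace Ω] (μ : Measure Ω) [IsProbabilityMeasure μ]
    {𝕜 : Type*} [RCLike 𝕜]
    {H : Type*} [NormedAddCommGroup H] [InnerProductSpace 𝕜 H] [NormedSpace ℝ H]
    [CompleteSpace H] [MeasurableSpace H] [BorelSpace H]
    (φ : ℝ → ℝ) (hφ : IsOrliczNFunction φ) (hφ1 : orliczInv φ 1 = 1)
    (n : ℕ) [NeZero n] (X : Fin n → Ω → H)
    (hmeas : ∀ i, AEStronglyMeasurable (X i) μ)
    (hindep : iIndepFun X μ)
    (hident : ∀ i, IdentDistrib (X i) (X 0) μ μ)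
    (δ : ℝ) (hδ : 0 < δ) (hδ1 : 1 ≤ Real.log (1 / δ)) (hn : Real.log (1 / δ) ≤ n) :
    ENNReal.ofReal (1 - δ) ≤
      μ {ω | ‖(1 / n : ℝ) • ∑ i, X i ω - ∫ ω', X 0 ω' ∂μ‖ₑ ≤
        ENNReal.ofReal (6 * Real.exp 1) * tauTildeNorm φ (fun ω' => ‖X 0 ω'‖) μ *
          ENNReal.ofReal (√(Real.log (1 / δ) / n))} := by
  set L := Real.log (1 / δ) with hL
  set τ := tauTildeNorm φ (fun ω' => ‖X 0 ω'‖) μ with hτ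
  have hn0 : (0 : ℝ) < n := by linarith
  have hs0 : 0 < √(L / n) := Real.sqrt_pos.2 (by positivity)
  have hmom : ∀ m : ℕ, 1 ≤ m → eLpNorm (X 0) m μ ≤ τ * m := fun m h => by
    rw [← eLpNorm_norm]
    exact eLpNorm_le_tauTildeNorm_mul hφ hφ1 _ h
  have hone : ENNReal.ofReal (1 - δ) ≤ 1 := ENNReal.ofReal_le_one.2 (by linarith)
  rcases eq_or_ne τ ∞ with htop | htop
  -- The other two factors are positive, so the right-hand side is `∞`.
  · have hset : ∀ ω, ‖(1 / n : ℝ) • ∑ i, X i ω - ∫ ω', X 0 ω' ∂μ‖ₑ ≤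
        ENNReal.ofReal (6 * Real.exp 1) * τ * ENNReal.ofReal (√(L / n)) := fun ω => by
      rw [htop, ENNReal.mul_top (by simp; positivity), ENNReal.top_mul (by simpa using hs0)]
      exact le_top
    rw [measure_congr (eventuallyEq_univ.2 (ae_of_all μ hset)), measure_univ]
    exact hone
  -- The scale `v / (e K)` needs `K > 0`. When `τ = 0` all the vectors vanish almost surely.
  rcases eq_or_ne τ 0 with hzero | hzero
  · have h0 : ∀ i, X i =ᵐ[μ] 0 := fun i => by
      rw [← eLpNorm_eq_zero_iff (hmeas i) one_ne_zero, (hident i).eLpNorm_eq 1]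
      simpa [hzero] using hmom 1 le_rfl
    have hall : ∀ᵐ ω ∂μ, ∀ i, X i ω = 0 := ae_all_iff.2 h0
    have hset : ∀ᵐ ω ∂μ, ‖(1 / n : ℝ) • ∑ i, X i ω - ∫ ω', X 0 ω' ∂μ‖ₑ ≤
        ENNReal.ofReal (6 * Real.exp 1) * τ * ENNReal.ofReal (√(L / n)) := by
      filter_upwards [hall] with ω hω
      simp [hω, integral_eq_zero_of_ae (h0 0)]
    rw [measure_congr (eventuallyEq_univ.2 hset), measure_univ]
    exact hone
  let _ : InnerProductSpace ℝ H := innerProductSpaceReal 𝕜 H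
  set K := τ.toReal with hKdef
  have hK : 0 < K := ENNReal.toReal_pos hzero htop
  have hKτ : ENNReal.ofReal K = τ := ENNReal.ofReal_toReal htop
  have key := measure_lt_norm_average_sub_le_of_aestronglyMeasurable (μ := μ) hmeas hindep
    (fun i => (hident i).integral_eq) hK
    (fun i m h => by
      rw [(hident i).eLpNorm_eq, ENNReal.ofReal_mul hK.le, hKτ, ENNReal.ofReal_natCast]
      exact hmom m h) hδ1 hn
  have hexp : Real.exp (-L) = δ := by
    rw [hL, one_div, Real.log_inv, neg_neg, Real.exp_log hδ]
  rw [hexp] at key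
  have hcompl : {ω | ‖(1 / n : ℝ) • ∑ i, X i ω - ∫ ω', X 0 ω' ∂μ‖ₑ ≤
        ENNReal.ofReal (6 * Real.exp 1) * τ * ENNReal.ofReal (√(L / n))}
      = {ω | 6 * Real.exp 1 * K * √(L / n)
          < ‖(1 / n : ℝ) • ∑ i, X i ω - ∫ ω', X 0 ω' ∂μ‖}ᶜ := by
    ext ω
    simp only [Set.mem_ofPred_eq, Set.mem_compl_iff, not_lt]
    rw [← hKτ, ← ENNReal.ofReal_mul (by positivity), ← ENNReal.ofReal_mul (by positivity),
      ← ofReal_norm, ENNReal.ofReal_le_ofReal_iff (by positivity)]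
  rw [hcompl, ENNReal.ofReal_sub _ hδ.le, ENNReal.ofReal_one, tsub_le_iff_right]
  calc (1 : ℝ≥0∞) = μ Set.univ := measure_univ.symm
    _ ≤ _ := by
      rw [← Set.compl_union_self {ω | 6 * Real.exp 1 * K * √(L / n)
          < ‖(1 / n : ℝ) • ∑ i, X i ω - ∫ ω', X 0 ω' ∂μ‖}]
      exact (measure_union_le _ _).trans (by gcongr)
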